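/- **Conventions.** If $F$ is a free group with basis $\mathbb X$ and $f:\mathbb X\to\mathbb N^+$ is a function, the word-length metric on $F$ determined by $(\mathbb X,f)$ is $L(x_1^{\pm1}\cdots x_r^{\pm1})=\sum_i f(x_i)$ for reduced words. A map $\phi:A\to B$ of sets with $\mathbb N$-valued length functions is *p-bounded* if there are constants $C,N\in\mathbb N$ with $L_B(\phi(a))\le C(1+L_A(a))^N$ for all $a\in A$. A *triple* $(\Gamma_\bullet^+,\mathbb X_\bullet,L_\bullet^+)$ over a group $\pi$ is a simplicial group $\Gamma_\bullet$ with an augmentation $\varepsilon:\Gamma_\bullet\to\pi$ that is surjective on $\Gamma_0$ (put $\Gamma_{-1}=\pi$), such that every $\Gamma_n$ with $n\ge 0$ is free with a given countable basis $\mathbb X_n$ and carries the word-length metric $L_n$ determined by a given function $\mathbb X_n\to\mathbb N^+$, all face and degeneracy maps are p-bounded, and $L_{-1}(g)=\min\{L_0(x)\mid x\in\Gamma_0,\ \varepsilon(x)=g\}$. Let $\Gamma(\varepsilon)_n=\ker(\Gamma_n\to\pi)$ for $n\ge 0$ and $\Gamma(\varepsilon)_{-1}=\{1\}$, with $\partial_0:\Gamma(\varepsilon)_0\to\Gamma(\varepsilon)_{-1}$.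 A *contraction through dimension $d$* of $\Gamma(\varepsilon)_\bullet$ is a family of maps of sets $s'_{n+1}:\Gamma(\varepsilon)_n\to\Gamma(\varepsilon)_{n+1}$, $-1\le n\le d$, with $\partial_{n+1}s'_{n+1}=\mathrm{id}$ for all such $n$, and $\partial_i s'_{n+1}=s'_n\partial_i$ for $0\le n\le d$ and $0\le i\le n$. The triple is of *type $P(m)$* ($m\ge 0$) if $\Gamma(\varepsilon)_\bullet$ has a contraction through dimension $m-1$ all of whose maps are p-bounded. It is a *type $P$ resolution of $\pi$* if $\varepsilon$ induces an isomorphism $\pi_0(\Gamma_\bullet)\cong\pi$, $\pi_n(\Gamma_\bullet)=0$ for all $n>0$, and $\Gamma(\varepsilon)_\bullet$ has a contraction defined in all dimensions $n\ge -1$ all of whose maps are p-bounded. An *inclusion* of triples over $\pi$ is an injective homomorphism of augmented simplicial groups that is the identity on $\pi$, maps $\mathbb X_n$ into $\widetilde{\mathbb X}_n$ preserving the weights of generators for every $n\ge 0$, and preserves the word-length function on $\pi$. **Theorem A.1.** Every triple over a group $\pi$ admits an inclusion into a triple over $\pi$ which is a type $P$ resolution of $\pi$. Moreover, if the given triple is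 of type $P(m)$, the inclusion can be chosen to be the identity in all simplicial degrees $\le m$ (an isomorphism of groups identifying the bases, the weights and hence the word-length functions). **Corollary A.8.** Every countable group $\pi$ has a type $P$ resolution, that is, there is a triple over $\pi$ which is a type $P$ resolution of $\pi$; in particular its word-length functions in non-negative degrees are $\mathbb N$-valued metrics. -/

import Mathlib

open CategoryTheory Opposite
open scoped Simplicial

universe u

noncomputable section

/-- A map of sets with length functions is p-bounded if the length of the image is bounded by a
polynomial in the length of the argument. -/
def IsPBounded {A B : Type*} (LA : A → ℕ) (LB : B → ℕ) (f : A → B) : Prop :=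
  ∃ C N : ℕ, ∀ a, LB (f a) ≤ C * (1 + LA a) ^ N

open Classical in
/-- The word-length metric on a free group `G` with basis `b` determined by a weight function on
the basis: the sum of the weights of the letters of the reduced word representing `g`. -/
def wordLength {S G : Type*} [Group G] (b : FreeGroupBasis S G) (w : S → ℕ+) (g : G) : ℕ :=
  ((b.repr g).toWord.map fun a => (w a.1 : ℕ)).sum

/-- A triple over `π`: a p-bounded augmented free simplicial group with `π` in degree `-1`, which
in every degree `n ≥ 0` carries a countable free basis and the word-length metric determined by a
positive integral weight function on that basis. -/
structure FreeTriple (π : Type u) [Group π] where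
  /-- the simplicial group -/
  X : SimplicialObject GrpCat.{u}
  /-- the augmentation -/
  aug : X ⟶ (SimplicialObject.const GrpCat.{u}).obj (GrpCat.of π)
  aug_surjective : Function.Surjective (aug.app (op ⦋0⦌)).hom
  /-- the generating set in each degree -/
  gens : ℕ → Type u
  countable_gens : ∀ n, Countable (gens n)
  basis : ∀ n, FreeGroupBasis (gens n) (X _⦋n⦌)
  /-- the weights of the generators -/
  weight : ∀ n, gens n → ℕ+
  face_pBounded : ∀ (n : ℕ) (i : Fin (n + 2)),
    IsPBounded (wordLength (basis (n + 1)) (weight (n + 1))) (wordLength (basis n) (weight n))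
      (X.δ i).hom
  degeneracy_pBounded : ∀ (n : ℕ) (i : Fin (n + 1)),
    IsPBounded (wordLength (basis n) (weight n)) (wordLength (basis (n + 1)) (weight (n + 1)))
      (X.σ i).hom

namespace FreeTriple

variable {π : Type u} [Group π] (T : FreeTriple π)

/-- The word-length metric in degree `n ≥ 0`. -/
def len (n : ℕ) : T.X _⦋n⦌ → ℕ := wordLength (T.basis n) (T.weight n)

/-- The word-length function in degree `-1`, induced from degree `0` by the augmentation. -/
def augLen (g : π) : ℕ := sInf {l | ∃ x : T.X _⦋0⦌, (T.aug.app (op ⦋0⦌)).hom x = g ∧ T.len 0 x = l}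

/-- The degree `n` part of the kernel of the augmentation. In degree `-1` this kernel is the
trivial group. -/
def ker (n : ℕ) : Subgroup (T.X _⦋n⦌) := (T.aug.app (op ⦋n⦌)).hom.ker

theorem face_mem_ker {n : ℕ} (i : Fin (n + 2)) {x : T.X _⦋n + 1⦌} (hx : x ∈ T.ker (n + 1)) :
    (T.X.δ i).hom x ∈ T.ker n := by
  have h := congrArg (fun f => f.hom x) (T.aug.naturality (SimplexCategory.δ i).op)
  exact Eq.trans h hx

/-- The face maps of the kernel of the augmentation. -/
def kerFace {n : ℕ} (i : Fin (n + 2)) (x : T.ker (n + 1)) : T.ker n :=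
  ⟨(T.X.δ i).hom x, T.face_mem_ker i x.2⟩

/-- The word-length metric restricted to the kernel of the augmentation. -/
def kerLen (n : ℕ) (x : T.ker n) : ℕ := T.len n x

/-- The requirements on a simplicial contraction of the kernel of the augmentation (as an augmented
simplicial set) in degree `n`. Here `s n` is the map from degree `n` to degree `n + 1`, and `s₀` is
the value of the map from degree `-1` (a one-point set) to degree `0`. The last face of `s n x` is
`x`, the other faces commute with the contraction, and `s n` is p-bounded. -/
def IsContractionAt (s₀ : T.ker 0) (s : ∀ n, T.ker n → T.ker (n + 1)) (n : ℕ) : Prop :=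
  match n with
  | 0 => (∀ x, T.kerFace (Fin.last 1) (s 0 x) = x) ∧
      (∀ x, T.kerFace 0 (s 0 x) = s₀) ∧
      IsPBounded (T.kerLen 0) (T.kerLen 1) (s 0)
  | n + 1 => (∀ x, T.kerFace (Fin.last (n + 2)) (s (n + 1) x) = x) ∧
      (∀ (i : Fin (n + 2)) (x), T.kerFace i.castSucc (s (n + 1) x) = s n (T.kerFace i x)) ∧
      IsPBounded (T.kerLen (n + 1)) (T.kerLen (n + 2)) (s (n + 1))

/-- Type `P(m)`: the kernel of the augmentation has a simplicial contraction through dimension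
`m - 1` which is p-bounded in each degree. -/
def IsTypePUpTo (m : ℕ) : Prop :=
  ∃ (s₀ : T.ker 0) (s : ∀ n, T.ker n → T.ker (n + 1)), ∀ n < m, T.IsContractionAt s₀ s n

/-- The simplicial group is a resolution of `π`: the augmentation identifies `π₀` with `π`, and the
higher homotopy groups (computed by the Moore complex) vanish. -/
def IsResolution : Prop :=
  (∀ x ∈ T.ker 0, ∃ y : T.X _⦋1⦌,
    (T.X.δ (0 : Fin 2)).hom y = 1 ∧ (T.X.δ (1 : Fin 2)).hom y = x) ∧
  ∀ (n : ℕ) (x : T.X _⦋n + 1⦌), (∀ i : Fin (n + 2), (T.X.δ i).hom x = 1) →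
    ∃ y : T.X _⦋n + 2⦌, (∀ i : Fin (n + 2), (T.X.δ i.castSucc).hom y = 1) ∧
      (T.X.δ (Fin.last (n + 2))).hom y = x

/-- Type `P` resolution of `π`: a resolution for which the kernel of the augmentation has a
simplicial contraction that is p-bounded in all degrees. -/
def IsTypePResolution : Prop :=
  T.IsResolution ∧
  ∃ (s₀ : T.ker 0) (s : ∀ n, T.ker n → T.ker (n + 1)), ∀ n, T.IsContractionAt s₀ s n

/-- An inclusion of triples over `π`: an injective map of augmented simplicial groups which is the
identity on `π` and which sends generators to generators, preserving weights in non-negative degrees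
and the induced word-length function on `π`. -/
structure Inclusion (T T' : FreeTriple π) where
  /-- the map of simplicial groups -/
  hom : T.X ⟶ T'.X
  hom_aug : hom ≫ T'.aug = T.aug
  injective : ∀ n : ℕ, Function.Injective (hom.app (op ⦋n⦌)).hom
  /-- the map of generating sets -/
  genMap : ∀ n, T.gens n → T'.gens n
  hom_basis : ∀ n x, (hom.app (op ⦋n⦌)).hom (T.basis n x) = T'.basis n (genMap n x)
  weight_genMap : ∀ n x, T'.weight n (genMap n x) = T.weight n x
  augLen_eq : ∀ g, T'.augLen g = T.augLen g

/-- The inclusion is an identification of free groups with generating set and word-length metric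
in degree `n`. -/
def Inclusion.IsIdentityAt {T T' : FreeTriple π} (ι : Inclusion T T') (n : ℕ) : Prop :=
  Function.Bijective (ι.hom.app (op ⦋n⦌)).hom ∧ Function.Bijective (ι.genMap n)

end FreeTriple

end

/-! A contraction is extended one degree at a time by attaching cones. If `s` contracts through
dimension m - 1, attach freely, for each x in the kernel in degree m, a cell of dimension m + 1
whose faces are those that s(x) must have: x as last face, s(∂ᵢx) as the others (s₀ when m = 0). The
contraction identities one degree below make these faces compatible (`kerFace_coneBd`,
`coneBd_compat_of_lt`). Nothing changes in degrees ≤ m, so every element of the degree m kernel has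
its cone, and the length on π is unaffected.

Polynomial bounds survive because a cell has weight one more than the length of x, its faces are
p-bounded in x, and a homomorphism of free groups is p-bounded once it is so on generators
(`IsPBounded.of_basis`); only finitely many surjections onto the simplex occur in each degree.

Iterating gives a sequence that stabilises in each degree; its union carries a p-bounded contraction
in all degrees (`exists_union`). Such a contraction kills homotopy: a Moore cycle x bounds
s(x)s(1)⁻¹. The case m = 0 needs no hypothesis, and the corollary starts from a constant free group.
-/

/-! ### Polynomial bounds and word lengths -/

theorem IsPBounded.comp {A B D : Type*} {LA : A → ℕ} {LB : B → ℕ} {LD : D → ℕ} {g : B → D}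
    {f : A → B} (hg : IsPBounded LB LD g) (hf : IsPBounded LA LB f) :
    IsPBounded LA LD (g ∘ f) := by
  obtain ⟨C, N, hC⟩ := hg
  obtain ⟨C', N', hC'⟩ := hf
  -- As 1 ≤ (1 + a)^N', one has 1 + C'(1 + a)^N' ≤ (1 + C')(1 + a)^N'; raise this to the power N.
  refine ⟨C * (1 + C') ^ N, N' * N, fun a => (hC _).trans ?_⟩
  rw [mul_assoc, pow_mul, ← mul_pow]
  refine Nat.mul_le_mul_left _ (Nat.pow_le_pow_left ?_ _)
  have h1 : 1 ≤ (1 + LA a) ^ N' := Nat.one_le_pow _ _ (by omega)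
  have h2 := hC' a
  rw [add_mul, one_mul]
  omega

theorem IsPBounded.of_le {A B : Type*} {LA : A → ℕ} {LB : B → ℕ} {f : A → B}
    (h : ∀ a, LB (f a) ≤ 1 + LA a) : IsPBounded LA LB f :=
  ⟨1, 1, fun a => by simpa using h a⟩

namespace FreeGroup

/-- An injective relabelling creates no new cancellation; this is why inclusions preserve word
length. -/
theorem isReduced_map_of_injective {S S' : Type*} {e : S → S'}
    (he : Function.Injective e) {l : List (S × Bool)} (hl : IsReduced l) :
    IsReduced (l.map fun a => (e a.1, a.2)) := by
  unfold IsReduced at hl ⊢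
  rw [List.isChain_map]
  exact hl.imp fun a b h hab => h (he hab)

theorem toWord_map_of_injective {S S' : Type*} [DecidableEq S] [DecidableEq S'] {e : S → S'}
    (he : Function.Injective e) (g : FreeGroup S) :
    (FreeGroup.map e g).toWord = g.toWord.map fun a => (e a.1, a.2) := by
  conv_lhs => rw [← FreeGroup.mk_toWord (x := g)]
  rw [FreeGroup.map.mk, FreeGroup.toWord_mk]
  exact (isReduced_map_of_injective he FreeGroup.isReduced_toWord).reduce_eq

end FreeGroup

section WordLength

variable {S G S' G' : Type*} [Group G] [Group G']

theorem wordLength_one (b : FreeGroupBasis S G) (w : S → ℕ+) : wordLength b w 1 = 0 := by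
  simp [wordLength]

theorem wordLength_basis (b : FreeGroupBasis S G) (w : S → ℕ+) (a : S) :
    wordLength b w (b a) = w a := by
  simp [wordLength]

theorem wordLength_inv (b : FreeGroupBasis S G) (w : S → ℕ+) (g : G) :
    wordLength b w g⁻¹ = wordLength b w g := by
  simp [wordLength, FreeGroup.toWord_inv, FreeGroup.invRev, Function.comp_def]

theorem wordLength_mul_le (b : FreeGroupBasis S G) (w : S → ℕ+) (g h : G) :
    wordLength b w (g * h) ≤ wordLength b w g + wordLength b w h := by
  classical
  unfold wordLength
  rw [map_mul, ← List.sum_append, ← List.map_append]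
  exact ((FreeGroup.toWord_mul_sublist _ _).map _).sum_le_sum (by simp)

theorem wordLength_lift_mk_le (b : FreeGroupBasis S G) (w : S → ℕ+) {T : Type*} (φ : T → G)
    (l : List (T × Bool)) :
    wordLength b w (FreeGroup.lift φ (FreeGroup.mk l)) ≤
      (l.map fun a => wordLength b w (φ a.1)).sum := by
  rw [FreeGroup.lift_mk]
  induction l with
  | nil => simp [wordLength_one]
  | cons a l ih =>
    rw [List.map_cons, List.prod_cons, List.map_cons, List.sum_cons]
    refine (wordLength_mul_le b w _ _).trans (Nat.add_le_add ?_ ih)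
    rcases a with ⟨a, _ | _⟩ <;> simp [wordLength_inv]

/-- A homomorphism of free groups is p-bounded as soon as it is so on generators. -/
theorem IsPBounded.of_basis (b : FreeGroupBasis S G) (w : S → ℕ+) (b' : FreeGroupBasis S' G')
    (w' : S' → ℕ+) (f : G →* G')
    (h : IsPBounded (fun a => (w a : ℕ)) (wordLength b' w') fun a => f (b a)) :
    IsPBounded (wordLength b w) (wordLength b' w') f := by
  classical
  obtain ⟨C, N, hC⟩ := h
  -- With M the length of g, each letter has weight at most M and so contributes at most C(1 + M)^N;
  -- there are at most M letters because weights are positive. This costs one extra power.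
  refine ⟨C, N + 1, fun g => ?_⟩
  have hg : f g = FreeGroup.lift (fun a => f (b a)) (FreeGroup.mk (b.repr g).toWord) := by
    have : f = (FreeGroup.lift fun a => f (b a)).comp b.repr.toMonoidHom :=
      b.ext_hom _ _ fun i => by simp
    rw [FreeGroup.mk_toWord]
    exact DFunLike.congr_fun this g
  rw [hg]
  refine (wordLength_lift_mk_le _ _ _ _).trans ?_
  unfold wordLength at hC ⊢
  generalize (b.repr g).toWord = l
  have hlen : l.length ≤ (l.map fun a => (w a.1 : ℕ)).sum := by
    induction l with
    | nil => simp
    | cons a l ih =>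
      have := (w a.1).pos
      simp only [List.length_cons, List.map_cons, List.sum_cons]
      omega
  set M := (l.map fun a => (w a.1 : ℕ)).sum with hM
  have key := List.sum_le_card_nsmul
    (l.map fun a => (((b'.repr (f (b a.1))).toWord.map fun a => (w' a.1 : ℕ)).sum))
    (C * (1 + M) ^ N) (by
      intro x hx
      obtain ⟨a, ha, rfl⟩ := List.mem_map.1 hx
      refine (hC a.1).trans (Nat.mul_le_mul_left _ (Nat.pow_le_pow_left ?_ _))
      exact Nat.add_le_add_left (List.single_le_sum (by simp) (w a.1 : ℕ)
        (List.mem_map_of_mem (f := fun a => (w a.1 : ℕ)) ha)) _)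
  rw [List.length_map, smul_eq_mul] at key
  refine key.trans ((Nat.mul_le_mul_right _ (hlen.trans (Nat.le_add_left M 1))).trans_eq ?_)
  ring

theorem wordLength_map_of_injective (b : FreeGroupBasis S G) (w : S → ℕ+)
    (b' : FreeGroupBasis S' G') (w' : S' → ℕ+) (f : G →* G') {e : S → S'}
    (he : Function.Injective e) (hf : ∀ a, f (b a) = b' (e a)) (hw : ∀ a, w' (e a) = w a) (g : G) :
    wordLength b' w' (f g) = wordLength b w g := by
  classical
  have h : b'.repr (f g) = FreeGroup.map e (b.repr g) := by
    have : b'.repr.toMonoidHom.comp f = (FreeGroup.map e).comp b.repr.toMonoidHom :=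
      b.ext_hom _ _ fun i => by simp [hf]
    exact DFunLike.congr_fun this g
  unfold wordLength
  rw [h]
  have := FreeGroup.toWord_map_of_injective he (b.repr g)
  convert congrArg (fun l => (List.map (fun a : S' × Bool => (w' a.1 : ℕ)) l).sum) this using 1
  simp [hw, Function.comp_def]

theorem wordLength_basis_map (b : FreeGroupBasis S G) (w : S → ℕ+) (e : G ≃* G') (g : G) :
    wordLength (b.map e) w (e g) = wordLength b w g := by
  simp [wordLength, FreeGroupBasis.map]

theorem FreeGroupBasis.bijective_of_bijective (b : FreeGroupBasis S G) (b' : FreeGroupBasis S' G')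
    (f : G →* G') {e : S → S'} (he : Function.Bijective e) (hf : ∀ a, f (b a) = b' (e a)) :
    Function.Bijective f := by
  have : f = ((b.repr.trans (FreeGroup.freeGroupCongr (Equiv.ofBijective e he))).trans
      b'.repr.symm).toMonoidHom := by
    refine b.ext_hom _ _ fun i => ?_
    simp only [hf, MulEquiv.toMonoidHom_eq_coe, MonoidHom.coe_coe, MulEquiv.trans_apply,
      FreeGroupBasis.repr_apply_coe]
    simp
    rfl
  rw [this]
  exact MulEquiv.bijective _

theorem FreeGroupBasis.countable [Countable S] (b : FreeGroupBasis S G) : Countable G := by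
  have : Countable (FreeGroup S) := by classical exact FreeGroup.toWord_injective.countable
  exact b.repr.injective.countable

theorem FreeGroupBasis.injective_of_injective (b : FreeGroupBasis S G)
    (b' : FreeGroupBasis S' G') (f : G →* G') {e : S → S'} (he : Function.Injective e)
    (hf : ∀ a, f (b a) = b' (e a)) : Function.Injective f := by
  have h : ∀ g, b'.repr (f g) = FreeGroup.map e (b.repr g) := fun g =>
    DFunLike.congr_fun (b.ext_hom (b'.repr.toMonoidHom.comp f)
      ((FreeGroup.map e).comp b.repr.toMonoidHom) fun i => by simp [hf]) g
  intro x y hxy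
  apply b.repr.injective
  apply FreeGroup.map_injective he
  rw [← h, ← h, hxy]

end WordLength

/-! ### Attaching free cells -/

noncomputable section

namespace FreeTriple

variable {π : Type u} [Group π]

/-- Data for attaching a family of free cells of dimension `m + 1` to a triple: for each cell a
compatible family of faces in the kernel of the augmentation, with p-bounded length. -/
structure CellData (T : FreeTriple π) (m : ℕ) where
  /-- the set of cells -/
  cells : Type u
  countable_cells : Countable cells
  /-- the size of a cell -/
  size : cells → ℕ
  /-- the faces of a cell -/
  bd : Fin (m + 2) → cells → T.X _⦋m⦌
  aug_bd : ∀ i x, (T.aug.app (op ⦋m⦌)).hom (bd i x) = 1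
  -- The two sides are the values assigned to one non-surjective operator by two factorisations
  -- through cofaces.
  compat : ∀ (x : cells) (i j : Fin (m + 2)) (Δ : SimplexCategory) (τ₁ τ₂ : Δ ⟶ ⦋m⦌),
    τ₁ ≫ SimplexCategory.δ i = τ₂ ≫ SimplexCategory.δ j →
      (T.X.map τ₁.op).hom (bd i x) = (T.X.map τ₂.op).hom (bd j x)
  bd_pBounded : ∀ i, IsPBounded size (T.len m) (bd i)

namespace CellData

variable {T : FreeTriple π} {m : ℕ} (D : T.CellData m)

/-- The surjective maps to the standard simplex of dimension `m + 1`. -/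
abbrev Surj (m : ℕ) (Δ : SimplexCategory) : Type :=
  {σ : Δ ⟶ ⦋m + 1⦌ // Function.Surjective σ.toOrderHom}

/-- The generators after attaching cells. -/
abbrev Gens (Δ : SimplexCategory) : Type u := T.gens Δ.len ⊕ (Surj m Δ × D.cells)

/-- The inclusion of the original group. -/
def incl (Δ : SimplexCategory) : T.X.obj (op Δ) →* FreeGroup (D.Gens Δ) :=
  (T.basis Δ.len).lift fun a => FreeGroup.of (Sum.inl a)

theorem incl_basis (Δ : SimplexCategory) (a : T.gens Δ.len) :
    D.incl Δ (T.basis Δ.len a) = FreeGroup.of (Sum.inl a) := by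
  simp [incl]

open Classical in
/-- The simplex `τ` of the cell `x`. -/
def elt {Δ : SimplexCategory} (τ : Δ ⟶ ⦋m + 1⦌) (x : D.cells) : FreeGroup (D.Gens Δ) :=
  if h : Function.Surjective τ.toOrderHom then FreeGroup.of (Sum.inr (⟨τ, h⟩, x))
  else D.incl Δ ((T.X.map
    (SimplexCategory.eq_comp_δ_of_not_surjective τ h).choose_spec.choose.op).hom
      (D.bd (SimplexCategory.eq_comp_δ_of_not_surjective τ h).choose x))

theorem elt_surj {Δ : SimplexCategory} (τ : Surj m Δ) (x : D.cells) :
    D.elt τ.1 x = FreeGroup.of (Sum.inr (τ, x)) := by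
  rw [elt, dif_pos τ.2]

theorem not_surjective_comp_δ {Δ : SimplexCategory} {n : ℕ} (τ : Δ ⟶ ⦋n⦌) (i : Fin (n + 2)) :
    ¬ Function.Surjective (τ ≫ SimplexCategory.δ i).toOrderHom := by
  intro h
  obtain ⟨k, hk⟩ := h i
  exact Fin.succAbove_ne i (τ.toOrderHom k) hk

/-- By `compat`, the factorisation chosen in `elt` is immaterial. This and `elt_surj` are all that
is used about `elt` afterwards. -/
theorem elt_comp_δ {Δ : SimplexCategory} (τ : Δ ⟶ ⦋m⦌) (i : Fin (m + 2)) (x : D.cells) :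
    D.elt (τ ≫ SimplexCategory.δ i) x = D.incl Δ ((T.X.map τ.op).hom (D.bd i x)) := by
  have h := not_surjective_comp_δ τ i
  rw [elt, dif_neg h]
  congr 1
  exact D.compat _ _ _ _ _ _
    (SimplexCategory.eq_comp_δ_of_not_surjective _ h).choose_spec.choose_spec.symm

/-- The simplicial operators after attaching cells. -/
def opHom {Δ Δ' : SimplexCategory} (θ : Δ' ⟶ Δ) : FreeGroup (D.Gens Δ) →* FreeGroup (D.Gens Δ') :=
  FreeGroup.lift (Sum.elim (fun a => D.incl Δ' ((T.X.map θ.op).hom (T.basis Δ.len a)))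
    fun c => D.elt (θ ≫ c.1.1) c.2)

theorem op_incl {Δ Δ' : SimplexCategory} (θ : Δ' ⟶ Δ) (g : T.X.obj (op Δ)) :
    D.opHom θ (D.incl Δ g) = D.incl Δ' ((T.X.map θ.op).hom g) :=
  DFunLike.congr_fun ((T.basis Δ.len).ext_hom ((D.opHom θ).comp (D.incl Δ))
    ((D.incl Δ').comp (T.X.map θ.op).hom) fun a => by
      simp only [MonoidHom.comp_apply, incl_basis]; simp [opHom]) g

/-- Allowing arbitrary τ is what makes `op_comp` formal: composing with θ can destroy surjectivity.
-/
theorem op_elt {Δ Δ' : SimplexCategory} (θ : Δ' ⟶ Δ) (τ : Δ ⟶ ⦋m + 1⦌) (x : D.cells) :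
    D.opHom θ (D.elt τ x) = D.elt (θ ≫ τ) x := by
  by_cases h : Function.Surjective τ.toOrderHom
  · rw [D.elt_surj ⟨τ, h⟩]
    simp [opHom]
  · obtain ⟨i, τ', rfl⟩ := SimplexCategory.eq_comp_δ_of_not_surjective τ h
    rw [elt_comp_δ, op_incl, ← Category.assoc, elt_comp_δ]
    simp

theorem op_id (Δ : SimplexCategory) : D.opHom (𝟙 Δ) = MonoidHom.id _ := by
  ext (a | c)
  · simpa [opHom] using D.incl_basis Δ a
  · simp [opHom, elt_surj]

theorem op_comp {Δ Δ' Δ'' : SimplexCategory} (θ : Δ' ⟶ Δ) (θ' : Δ'' ⟶ Δ') :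
    D.opHom (θ' ≫ θ) = (D.opHom θ').comp (D.opHom θ) := by
  ext (a | c)
  · rw [MonoidHom.comp_apply, ← incl_basis, op_incl, op_incl, op_incl]
    simp
  · rw [MonoidHom.comp_apply, ← elt_surj, op_elt, op_elt, op_elt, Category.assoc]

/-- The simplicial group obtained by attaching cells. -/
def obj : SimplicialObject GrpCat.{u} where
  obj Δ := GrpCat.of (FreeGroup (D.Gens Δ.unop))
  map θ := GrpCat.ofHom (D.opHom θ.unop)
  map_id Δ := by rw [unop_id, op_id]; rfl
  map_comp θ θ' := by rw [unop_comp, op_comp]; rfl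

/-- The augmentation after attaching cells. -/
def augHom (Δ : SimplexCategory) : FreeGroup (D.Gens Δ) →* π :=
  FreeGroup.lift (Sum.elim (fun a => (T.aug.app (op Δ)).hom (T.basis Δ.len a)) fun _ => 1)

theorem augHom_incl (Δ : SimplexCategory) (g : T.X.obj (op Δ)) :
    D.augHom Δ (D.incl Δ g) = (T.aug.app (op Δ)).hom g :=
  DFunLike.congr_fun ((T.basis Δ.len).ext_hom ((D.augHom Δ).comp (D.incl Δ))
    (T.aug.app (op Δ)).hom fun a => by
      simp only [MonoidHom.comp_apply, incl_basis]; simp [augHom]) g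

end CellData

theorem aug_map (T : FreeTriple π) {Δ Δ' : SimplexCategory} (θ : Δ' ⟶ Δ) (g : T.X.obj (op Δ)) :
    (T.aug.app (op Δ')).hom ((T.X.map θ.op).hom g) = (T.aug.app (op Δ)).hom g :=
  congrArg (fun f => f.hom g) (T.aug.naturality θ.op)

namespace CellData

variable {T : FreeTriple π} {m : ℕ} (D : T.CellData m)

theorem augHom_elt {Δ : SimplexCategory} (τ : Δ ⟶ ⦋m + 1⦌) (x : D.cells) :
    D.augHom Δ (D.elt τ x) = 1 := by
  by_cases h : Function.Surjective τ.toOrderHom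
  · rw [D.elt_surj ⟨τ, h⟩]
    simp [augHom]
  · obtain ⟨i, τ', rfl⟩ := SimplexCategory.eq_comp_δ_of_not_surjective τ h
    rw [elt_comp_δ, augHom_incl, aug_map]
    exact D.aug_bd i x

theorem augHom_op {Δ Δ' : SimplexCategory} (θ : Δ' ⟶ Δ) :
    (D.augHom Δ').comp (D.opHom θ) = D.augHom Δ := by
  ext (a | c)
  · rw [MonoidHom.comp_apply, ← incl_basis, op_incl, augHom_incl, augHom_incl, aug_map]
  · rw [MonoidHom.comp_apply, ← elt_surj, op_elt, augHom_elt, augHom_elt]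

/-- The augmentation after attaching cells. -/
def aug : D.obj ⟶ (SimplicialObject.const GrpCat.{u}).obj (GrpCat.of π) where
  app Δ := GrpCat.ofHom (D.augHom Δ.unop)
  naturality Δ Δ' θ := by
    ext x
    exact DFunLike.congr_fun (D.augHom_op θ.unop) x

/-- The weights after attaching cells. -/
def weight (Δ : SimplexCategory) : D.Gens Δ → ℕ+ :=
  -- The shift by one keeps weights positive when the size is 0.
  Sum.elim (T.weight Δ.len) fun c => (D.size c.2).succPNat

theorem wordLength_incl (Δ : SimplexCategory) (g : T.X.obj (op Δ)) :
    wordLength (FreeGroupBasis.ofFreeGroup (D.Gens Δ)) (D.weight Δ) (D.incl Δ g) =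
      T.len Δ.len g :=
  wordLength_map_of_injective (T.basis Δ.len) (T.weight Δ.len) _ _ (D.incl Δ)
    Sum.inl_injective (fun a => D.incl_basis Δ a) (fun _ => rfl) g

end CellData
end FreeTriple
end

/-! ### Polynomial bounds after attaching cells -/

theorem IsPBounded.finite_prod {ι A B : Type*} [Finite ι] {LA : A → ℕ} {LB : B → ℕ}
    {f : ι → A → B} (h : ∀ i, IsPBounded LA LB (f i)) :
    IsPBounded (fun p : ι × A => LA p.2) LB fun p => f p.1 p.2 := by
  have := Fintype.ofFinite ι
  choose C N h using h
  refine ⟨∑ i, C i, ∑ i, N i, fun p => (h p.1 p.2).trans (Nat.mul_le_mul ?_ ?_)⟩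
  · exact Finset.single_le_sum (f := C) (fun _ _ => Nat.zero_le _) (Finset.mem_univ _)
  · exact Nat.pow_le_pow_right (by omega)
      (Finset.single_le_sum (f := N) (fun _ _ => Nat.zero_le _) (Finset.mem_univ _))

theorem IsPBounded.sum_elim {A A' B : Type*} {LA : A → ℕ} {LA' : A' → ℕ} {LB : B → ℕ}
    {f : A → B} {f' : A' → B} (h : IsPBounded LA LB f) (h' : IsPBounded LA' LB f') :
    IsPBounded (Sum.elim LA LA') LB (Sum.elim f f') := by
  obtain ⟨C, N, h⟩ := h
  obtain ⟨C', N', h'⟩ := h'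
  refine ⟨C + C', N + N', ?_⟩
  rintro (a | a)
  · exact (h a).trans (Nat.mul_le_mul (by omega) (Nat.pow_le_pow_right (by simp) (by omega)))
  · exact (h' a).trans (Nat.mul_le_mul (by omega) (Nat.pow_le_pow_right (by simp) (by omega)))

theorem IsPBounded.mono {A B : Type*} {LA LA' : A → ℕ} {LB : B → ℕ} {f : A → B}
    (h : IsPBounded LA LB f) (hL : ∀ a, LA a ≤ LA' a) : IsPBounded LA' LB f := by
  obtain ⟨C, N, h⟩ := h
  exact ⟨C, N, fun a => (h a).trans
    (Nat.mul_le_mul_left _ (Nat.pow_le_pow_left (Nat.add_le_add_left (hL a) 1) _))⟩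

noncomputable section

namespace FreeTriple

variable {π : Type u} [Group π]

/-- All simplicial operators of a triple are p-bounded. -/
theorem map_pBounded (T : FreeTriple π) {Δ Δ' : SimplexCategory} (θ : Δ' ⟶ Δ) :
    IsPBounded (T.len Δ.len) (T.len Δ'.len) (T.X.map θ.op).hom := by
  -- Cofaces and codegeneracies generate the simplex category, and p-bounded maps are closed under
  -- composition.
  let W : MorphismProperty SimplexCategory := fun Δ' Δ θ =>
    IsPBounded (T.len Δ.len) (T.len Δ'.len) (T.X.map θ.op).hom
  have : W.IsMultiplicative :=
    { id_mem := fun Δ => IsPBounded.of_le fun a => by simp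
      comp_mem := fun f g hf hg => by
        have h := IsPBounded.comp hf hg
        change IsPBounded _ _ _
        convert h using 1
        ext x
        simp }
  have h := SimplexCategory.morphismProperty_eq_top W (fun {n} i => T.face_pBounded n i)
    (fun {n} i => T.degeneracy_pBounded n i)
  have : W θ := by rw [h]; trivial
  exact this

namespace CellData

variable {T : FreeTriple π} {m : ℕ} (D : T.CellData m)

theorem elt_pBounded {Δ : SimplexCategory} (τ : Δ ⟶ ⦋m + 1⦌) :
    IsPBounded D.size (wordLength (FreeGroupBasis.ofFreeGroup (D.Gens Δ)) (D.weight Δ))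
      (D.elt τ) := by
  by_cases h : Function.Surjective τ.toOrderHom
  · refine IsPBounded.of_le fun x => ?_
    rw [D.elt_surj ⟨τ, h⟩, ← FreeGroupBasis.ofFreeGroup_apply, wordLength_basis]
    simp [weight, add_comm]
  · obtain ⟨i, τ', rfl⟩ := SimplexCategory.eq_comp_δ_of_not_surjective τ h
    obtain ⟨C, N, hC⟩ := (T.map_pBounded τ').comp (D.bd_pBounded i)
    refine ⟨C, N, fun x => ?_⟩
    rw [elt_comp_δ, wordLength_incl]
    exact hC x

theorem op_pBounded {Δ Δ' : SimplexCategory} (θ : Δ' ⟶ Δ) :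
    IsPBounded (wordLength (FreeGroupBasis.ofFreeGroup (D.Gens Δ)) (D.weight Δ))
      (wordLength (FreeGroupBasis.ofFreeGroup (D.Gens Δ')) (D.weight Δ')) (D.opHom θ) := by
  apply IsPBounded.of_basis
  have h1 : IsPBounded (fun a => (T.weight Δ.len a : ℕ))
      (wordLength (FreeGroupBasis.ofFreeGroup (D.Gens Δ')) (D.weight Δ'))
      (fun a => D.incl Δ' ((T.X.map θ.op).hom (T.basis Δ.len a))) := by
    obtain ⟨C, N, hC⟩ := T.map_pBounded θ
    refine ⟨C, N, fun a => ?_⟩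
    rw [wordLength_incl]
    refine (hC _).trans_eq ?_
    rw [len, wordLength_basis]
  -- Finitely many surjections occur, so one polynomial serves all of them.
  have h2 := IsPBounded.finite_prod fun τ : Surj m Δ => D.elt_pBounded (θ ≫ τ.1)
  have h := (h1.sum_elim h2).mono (LA' := fun a => (D.weight Δ a : ℕ)) (by
    rintro (a | c) <;> simp [weight])
  convert h using 1
  ext1 a
  simp [opHom]

/-- The triple obtained by attaching cells. -/
def attach : FreeTriple π where
  X := D.obj
  aug := D.aug
  aug_surjective g := by
    obtain ⟨x, hx⟩ := T.aug_surjective g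
    exact ⟨D.incl ⦋0⦌ x, (D.augHom_incl ⦋0⦌ x).trans hx⟩
  gens n := D.Gens ⦋n⦌
  countable_gens n := by
    have := D.countable_cells
    have := T.countable_gens n
    have : Countable (⦋n⦌ ⟶ ⦋m + 1⦌) := by
      have : Function.Injective fun f : ⦋n⦌ ⟶ ⦋m + 1⦌ =>
          (f.toOrderHom : Fin (n + 1) → Fin (m + 2)) :=
        fun f g h => by ext x : 3; exact congrFun h x
      exact this.countable
    exact inferInstanceAs (Countable (T.gens n ⊕ (Surj m ⦋n⦌ × D.cells)))
  basis n := FreeGroupBasis.ofFreeGroup (D.Gens ⦋n⦌)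
  weight n := D.weight ⦋n⦌
  face_pBounded n i := D.op_pBounded (SimplexCategory.δ i)
  degeneracy_pBounded n i := D.op_pBounded (SimplexCategory.σ i)

end CellData

/-- Surjectivity in degree 0 matters: an additional element there could be a shorter lift of g. -/
theorem augLen_eq_of_surjective (T T' : FreeTriple π) (f : T.X _⦋0⦌ →* T'.X _⦋0⦌)
    (hf : Function.Surjective f)
    (haug : ∀ x, (T'.aug.app (op ⦋0⦌)).hom (f x) = (T.aug.app (op ⦋0⦌)).hom x)
    (hlen : ∀ x, T'.len 0 (f x) = T.len 0 x) (g : π) : T'.augLen g = T.augLen g := by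
  unfold augLen
  congr 1
  ext l
  constructor
  · rintro ⟨y, hy, rfl⟩
    obtain ⟨x, rfl⟩ := hf y
    exact ⟨x, by rw [← hy, haug], (hlen x).symm⟩
  · rintro ⟨x, hx, rfl⟩
    exact ⟨f x, by rw [haug, hx], hlen x⟩

namespace CellData

variable {T : FreeTriple π} {m : ℕ} (D : T.CellData m)

/-- Hence cells of dimension m + 1 add no generators in degrees ≤ m. -/
theorem isEmpty_surj {n : ℕ} (h : n ≤ m) : IsEmpty (Surj m ⦋n⦌) :=
  ⟨fun σ => by
    have : Fintype.card (Fin (m + 2)) ≤ Fintype.card (Fin (n + 1)) :=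
      Fintype.card_le_of_surjective σ.1.toOrderHom σ.2
    simp at this
    omega⟩

theorem bijective_inl {n : ℕ} (h : n ≤ m) :
    Function.Bijective (Sum.inl : T.gens n → D.Gens ⦋n⦌) := by
  have := isEmpty_surj h
  refine ⟨Sum.inl_injective, ?_⟩
  rintro (a | c)
  · exact ⟨a, rfl⟩
  · exact isEmptyElim c.1

theorem bijective_incl {n : ℕ} (h : n ≤ m) : Function.Bijective (D.incl ⦋n⦌) :=
  (T.basis n).bijective_of_bijective (FreeGroupBasis.ofFreeGroup (D.Gens ⦋n⦌)) _
    (D.bijective_inl h) fun a => D.incl_basis ⦋n⦌ a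

/-- The inclusion of a triple in the one obtained by attaching cells. -/
def inclusion : Inclusion T D.attach where
  hom :=
    { app Δ := GrpCat.ofHom (D.incl Δ.unop)
      naturality Δ Δ' θ := by
        ext x
        exact (D.op_incl θ.unop x).symm }
  hom_aug := by
    ext Δ x
    exact D.augHom_incl Δ.unop x
  injective n := (T.basis n).injective_of_injective (FreeGroupBasis.ofFreeGroup (D.Gens ⦋n⦌))
    (D.incl ⦋n⦌) Sum.inl_injective fun a => D.incl_basis ⦋n⦌ a
  genMap n := Sum.inl
  hom_basis n x := D.incl_basis ⦋n⦌ x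
  weight_genMap n x := rfl
  augLen_eq := augLen_eq_of_surjective T D.attach (D.incl ⦋0⦌)
    (D.bijective_incl (Nat.zero_le m)).2 (D.augHom_incl ⦋0⦌) (D.wordLength_incl ⦋0⦌)

theorem inclusion_isIdentityAt {n : ℕ} (h : n ≤ m) : D.inclusion.IsIdentityAt n :=
  ⟨D.bijective_incl h, D.bijective_inl h⟩

end CellData
end FreeTriple

/-! ### Cones as attaching data -/

namespace FreeTriple

variable {π : Type u} [Group π]

theorem kerFace_comp (T : FreeTriple π) {n : ℕ} {i j : Fin (n + 2)} (h : i ≤ j)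
    (x : T.ker (n + 2)) :
    T.kerFace i (T.kerFace j.succ x) = T.kerFace j (T.kerFace i.castSucc x) :=
  Subtype.ext (congrArg (fun f => f.hom x.1) (T.X.δ_comp_δ h))

/-- The faces, other than the last one, of the cone on `x` in a contraction. -/
def coneFace (T : FreeTriple π) (s₀ : T.ker 0) (s : ∀ n, T.ker n → T.ker (n + 1)) :
    (n : ℕ) → Fin (n + 1) → T.ker n → T.ker n := fun n =>
  match n with
  | 0 => fun _ _ => s₀
  | n + 1 => fun i x => s n (T.kerFace i x)

theorem isContractionAt_iff (T : FreeTriple π) (s₀ : T.ker 0)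
    (s : ∀ n, T.ker n → T.ker (n + 1)) (n : ℕ) :
    T.IsContractionAt s₀ s n ↔ (∀ x, T.kerFace (Fin.last (n + 1)) (s n x) = x) ∧
      (∀ i x, T.kerFace i.castSucc (s n x) = T.coneFace s₀ s n i x) ∧
      IsPBounded (T.kerLen n) (T.kerLen (n + 1)) (s n) := by
  cases n with
  | zero =>
    refine and_congr_right fun _ => and_congr_left fun _ => ⟨fun h i x => ?_, fun h x => h 0 x⟩
    rw [Fin.eq_zero i]
    exact h x
  | succ n => rfl

/-- All faces of the cone on `x` in a contraction. -/
def coneBd (T : FreeTriple π) (s₀ : T.ker 0) (s : ∀ n, T.ker n → T.ker (n + 1)) (n : ℕ)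
    (i : Fin (n + 2)) (x : T.ker n) : T.ker n :=
  Fin.lastCases x (fun i => T.coneFace s₀ s n i x) i

section

variable (T : FreeTriple π) (s₀ : T.ker 0) (s : ∀ n, T.ker n → T.ker (n + 1))

@[simp]
theorem coneBd_last (n : ℕ) (x : T.ker n) : T.coneBd s₀ s n (Fin.last _) x = x := by
  simp [coneBd]

@[simp]
theorem coneBd_castSucc (n : ℕ) (i : Fin (n + 1)) (x : T.ker n) :
    T.coneBd s₀ s n i.castSucc x = T.coneFace s₀ s n i x := by
  simp [coneBd]

variable {s₀ s}

/-- These are the simplicial identities for the prescribed faces of a cone. If j is last, both sides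
are ∂ᵢx because the last face undoes `s`; otherwise both are `s` applied to the same iterated face
of x, or s₀ when m = 0. -/
theorem kerFace_coneBd {m : ℕ} (h : T.IsContractionAt s₀ s m) {i j : Fin (m + 2)} (hij : i ≤ j)
    (x : T.ker (m + 1)) :
    T.kerFace j (T.coneBd s₀ s (m + 1) i.castSucc x) =
      T.kerFace i (T.coneBd s₀ s (m + 1) j.succ x) := by
  rw [isContractionAt_iff] at h
  obtain ⟨h1, h2, -⟩ := h
  rw [coneBd_castSucc]
  cases j using Fin.lastCases with
  | last =>
    rw [Fin.succ_last, coneBd_last]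
    exact h1 _
  | cast j =>
    rw [Fin.succ_castSucc, coneBd_castSucc]
    cases i using Fin.lastCases with
    | last => exact absurd hij (not_le.2 (Fin.castSucc_lt_last j))
    | cast i =>
      change T.kerFace _ (s m _) = T.kerFace _ (s m _)
      rw [h2, h2]
      cases m with
      | zero => rfl
      | succ m =>
        change s m _ = s m _
        rw [kerFace_comp T (Fin.castSucc_le_castSucc_iff.1 hij)]

/-- The common composite omits both i and j, so it factors through a face of codimension two, where
`kerFace_coneBd` applies. -/
theorem coneBd_compat_of_lt {m : ℕ} (h : ∀ n < m, T.IsContractionAt s₀ s n) (x : T.ker m)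
    {i j : Fin (m + 2)} (hij : i < j) {Δ : SimplexCategory} (τ₁ τ₂ : Δ ⟶ ⦋m⦌)
    (hτ : τ₁ ≫ SimplexCategory.δ i = τ₂ ≫ SimplexCategory.δ j) :
    (T.X.map τ₁.op).hom (T.coneBd s₀ s m i x).1 = (T.X.map τ₂.op).hom (T.coneBd s₀ s m j x).1 := by
  have hv : ∀ k, i.succAbove (τ₁.toOrderHom k) = j.succAbove (τ₂.toOrderHom k) := fun k =>
    congrArg (fun f : Δ ⟶ ⦋m + 1⦌ => f.toOrderHom k) hτ
  cases m with
  | zero =>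
    -- A vertex in the common image would be a vertex of ⦋1⦌ different from both of its two
    -- vertices.
    have h₁ := Fin.succAbove_ne i (τ₁.toOrderHom 0)
    have h₂ := Fin.succAbove_ne j (τ₂.toOrderHom 0)
    rw [← hv 0] at h₂
    generalize i.succAbove (τ₁.toOrderHom 0) = k at h₁ h₂
    simp only [ne_eq, Fin.ext_iff] at h₁ h₂
    omega
  | succ m =>
    obtain ⟨i, rfl⟩ := Fin.exists_castSucc_eq.2 (Fin.ne_last_of_lt hij)
    obtain ⟨j, rfl⟩ := Fin.exists_succ_eq.2 (Fin.ne_zero_of_lt hij)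
    have hij' : i ≤ j := Fin.castSucc_lt_succ_iff.1 hij
    -- If τ₁ hit j, the common composite would hit `j.succ`, which the other side omits.
    obtain ⟨τ₃, rfl⟩ := SimplexCategory.eq_comp_δ_of_not_surjective' τ₁ j fun k hk => by
      have := hv k
      rw [hk, Fin.succAbove_castSucc_of_le _ _ hij'] at this
      exact Fin.succAbove_ne _ _ this.symm
    have : τ₂ = τ₃ ≫ SimplexCategory.δ i := by
      rw [← cancel_mono (SimplexCategory.δ j.succ), ← hτ, Category.assoc, Category.assoc,
        SimplexCategory.δ_comp_δ hij']
    subst this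
    rw [op_comp, op_comp, T.X.map_comp, T.X.map_comp]
    exact congrArg (fun y => (T.X.map τ₃.op).hom y.1)
      (T.kerFace_coneBd (h m (Nat.lt_succ_self m)) hij' x)

theorem kerFace_pBounded {n : ℕ} (i : Fin (n + 2)) :
    IsPBounded (T.kerLen (n + 1)) (T.kerLen n) (T.kerFace i) := by
  obtain ⟨C, N, h⟩ := T.face_pBounded n i
  exact ⟨C, N, fun x => h x.1⟩

theorem coneBd_pBounded {m : ℕ} (h : ∀ n < m, T.IsContractionAt s₀ s n) (i : Fin (m + 2)) :
    IsPBounded (T.kerLen m) (T.kerLen m) (T.coneBd s₀ s m i) := by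
  cases i using Fin.lastCases with
  | last => exact IsPBounded.of_le fun x => by simp
  | cast i =>
    cases m with
    | zero =>
      refine ⟨T.kerLen 0 s₀, 0, fun x => ?_⟩
      simp [coneFace]
    | succ m =>
      have := (((isContractionAt_iff ..).1 (h m m.lt_succ_self)).2.2).comp (T.kerFace_pBounded i)
      convert this using 1
      ext1 x
      simp [coneFace]

/-- The cones on the elements of the kernel of the augmentation in degree `m`. -/
def coneCells {m : ℕ} (h : ∀ n < m, T.IsContractionAt s₀ s n) : T.CellData m where
  cells := T.ker m
  countable_cells := by
    have := T.countable_gens m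
    have := (T.basis m).countable
    infer_instance
  size := T.kerLen m
  bd i x := (T.coneBd s₀ s m i x).1
  aug_bd i x := (T.coneBd s₀ s m i x).2
  compat x i j Δ τ₁ τ₂ hτ := by
    rcases lt_trichotomy i j with hij | rfl | hij
    · exact T.coneBd_compat_of_lt h x hij τ₁ τ₂ hτ
    · rw [cancel_mono] at hτ
      rw [hτ]
    · exact (T.coneBd_compat_of_lt h x hij τ₂ τ₁ hτ.symm).symm
  bd_pBounded i := T.coneBd_pBounded h i

end

/-! ### Transport of contractions -/

section KerMap

variable {T T' : FreeTriple π} (f : T.X ⟶ T'.X) (hf : f ≫ T'.aug = T.aug)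

include hf in
theorem aug_hom_app (n : ℕ) (x : T.X _⦋n⦌) :
    (T'.aug.app (op ⦋n⦌)).hom ((f.app (op ⦋n⦌)).hom x) = (T.aug.app (op ⦋n⦌)).hom x := by
  rw [← hf]
  rfl

/-- The map on kernels of the augmentation induced by an augmented simplicial map. -/
def kerMap (n : ℕ) (x : T.ker n) : T'.ker n :=
  ⟨(f.app (op ⦋n⦌)).hom x.1, (aug_hom_app f hf n x.1).trans x.2⟩

theorem kerFace_kerMap {n : ℕ} (i : Fin (n + 2)) (x : T.ker (n + 1)) :
    T'.kerFace i (kerMap f hf (n + 1) x) = kerMap f hf n (T.kerFace i x) :=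
  Subtype.ext (congrArg (fun g => g.hom x.1) (f.naturality (SimplexCategory.δ i).op)).symm

theorem kerMap_surjective {n : ℕ} (h : Function.Surjective (f.app (op ⦋n⦌)).hom) :
    Function.Surjective (kerMap f hf n) := by
  rintro ⟨y, hy⟩
  obtain ⟨x, rfl⟩ := h y
  exact ⟨⟨x, (aug_hom_app f hf n x).symm.trans hy⟩, rfl⟩

theorem kerMap_injective {n : ℕ} (h : Function.Injective (f.app (op ⦋n⦌)).hom) :
    Function.Injective (kerMap f hf n) :=
  fun _ _ hxy => Subtype.ext (h (congrArg Subtype.val hxy))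

theorem kerMap_bijective {n : ℕ} (h : Function.Bijective (f.app (op ⦋n⦌)).hom) :
    Function.Bijective (kerMap f hf n) :=
  ⟨kerMap_injective f hf h.1, kerMap_surjective f hf h.2⟩

variable {s₀ : T.ker 0} {s : ∀ n, T.ker n → T.ker (n + 1)}
  {s' : ∀ n, T'.ker n → T'.ker (n + 1)}

theorem coneFace_kerMap {n : ℕ}
    (hprev : ∀ k < n, ∀ x, s' k (kerMap f hf k x) = kerMap f hf (k + 1) (s k x))
    (i : Fin (n + 1)) (x : T.ker n) :
    T'.coneFace (kerMap f hf 0 s₀) s' n i (kerMap f hf n x) =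
      kerMap f hf n (T.coneFace s₀ s n i x) := by
  cases n with
  | zero => rfl
  | succ n =>
    change s' n _ = kerMap f hf (n + 1) (s n _)
    rw [kerFace_kerMap, hprev n n.lt_succ_self]

/-- Transport of a contraction along a map which is an isomorphism in the relevant degrees. -/
theorem IsContractionAt.map {n : ℕ} (h : T.IsContractionAt s₀ s n)
    (hsurj : Function.Surjective (f.app (op ⦋n⦌)).hom)
    (hlen : ∀ x, T'.len n ((f.app (op ⦋n⦌)).hom x) = T.len n x)
    (hlen' : ∀ x, T'.len (n + 1) ((f.app (op ⦋n + 1⦌)).hom x) = T.len (n + 1) x)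
    (hs : ∀ k ≤ n, ∀ x, s' k (kerMap f hf k x) = kerMap f hf (k + 1) (s k x)) :
    T'.IsContractionAt (kerMap f hf 0 s₀) s' n := by
  rw [isContractionAt_iff] at h ⊢
  obtain ⟨h1, h2, C, N, h3⟩ := h
  have hsurj := kerMap_surjective f hf hsurj
  refine ⟨fun y => ?_, fun i y => ?_, C, N, fun y => ?_⟩ <;> obtain ⟨x, rfl⟩ := hsurj y
  · rw [hs n le_rfl, kerFace_kerMap, h1]
  · rw [hs n le_rfl, kerFace_kerMap, h2, coneFace_kerMap f hf fun k hk => hs k hk.le]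
  · rw [hs n le_rfl]
    refine (hlen' _).trans_le ((h3 x).trans_eq ?_)
    congr 3
    exact (hlen _).symm

end KerMap

/-! ### Inclusions and the extension by one degree -/

namespace Inclusion

variable {T T' T'' : FreeTriple π}

theorem genMap_injective (ι : Inclusion T T') (n : ℕ) : Function.Injective (ι.genMap n) := by
  intro a b hab
  apply (T.basis n).injective
  apply ι.injective n
  rw [ι.hom_basis, ι.hom_basis, hab]

theorem len_hom (ι : Inclusion T T') (n : ℕ) (x : T.X _⦋n⦌) :
    T'.len n ((ι.hom.app (op ⦋n⦌)).hom x) = T.len n x :=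
  wordLength_map_of_injective _ _ _ _ (ι.hom.app (op ⦋n⦌)).hom (ι.genMap_injective n)
    (ι.hom_basis n) (ι.weight_genMap n) x

/-- The identity inclusion. -/
def refl (T : FreeTriple π) : Inclusion T T where
  hom := 𝟙 _
  hom_aug := Category.id_comp _
  injective _ := Function.injective_id
  genMap _ := id
  hom_basis _ _ := rfl
  weight_genMap _ _ := rfl
  augLen_eq _ := rfl

/-- The composition of inclusions. -/
def comp (ι : Inclusion T T') (ι' : Inclusion T' T'') : Inclusion T T'' where
  hom := ι.hom ≫ ι'.hom
  hom_aug := by rw [Category.assoc, ι'.hom_aug, ι.hom_aug]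
  injective n := (ι'.injective n).comp (ι.injective n)
  genMap n := ι'.genMap n ∘ ι.genMap n
  hom_basis n x :=
    (congrArg (ι'.hom.app (op ⦋n⦌)).hom (ι.hom_basis n x)).trans (ι'.hom_basis n _)
  weight_genMap n x := (ι'.weight_genMap n _).trans (ι.weight_genMap n x)
  augLen_eq g := (ι'.augLen_eq g).trans (ι.augLen_eq g)

theorem IsIdentityAt.refl (T : FreeTriple π) (n : ℕ) : (Inclusion.refl T).IsIdentityAt n :=
  ⟨Function.bijective_id, Function.bijective_id⟩

theorem IsIdentityAt.comp {ι : Inclusion T T'} {ι' : Inclusion T' T''} {n : ℕ}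
    (h : ι.IsIdentityAt n) (h' : ι'.IsIdentityAt n) : (ι.comp ι').IsIdentityAt n :=
  ⟨h'.1.comp h.1, h'.2.comp h.2⟩

end Inclusion

/-- A contraction through dimension `m - 1` extends to dimension `m` after enlarging the triple
in degrees greater than `m`. -/
theorem exists_extend_contraction (T : FreeTriple π) (m : ℕ) (s₀ : T.ker 0)
    (s : ∀ n, T.ker n → T.ker (n + 1)) (h : ∀ n < m, T.IsContractionAt s₀ s n) :
    ∃ (T' : FreeTriple π) (ι : Inclusion T T') (s' : ∀ n, T'.ker n → T'.ker (n + 1)),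
      (∀ n ≤ m, ι.IsIdentityAt n) ∧
      (∀ n < m, ∀ x, s' n (kerMap ι.hom ι.hom_aug n x) =
        kerMap ι.hom ι.hom_aug (n + 1) (s n x)) ∧
      ∀ n ≤ m, T'.IsContractionAt (kerMap ι.hom ι.hom_aug 0 s₀) s' n := by
  let D := T.coneCells h
  let ι := D.inclusion
  have hid : ∀ n ≤ m, ι.IsIdentityAt n := fun n hn => D.inclusion_isIdentityAt hn
  have hbij : ∀ n ≤ m, Function.Bijective (kerMap ι.hom ι.hom_aug n) := fun n hn =>
    kerMap_bijective _ _ (hid n hn).1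
  let cone : T.ker m → D.attach.ker (m + 1) := fun x => ⟨D.elt (𝟙 ⦋m + 1⦌) x, D.augHom_elt _ x⟩
  obtain ⟨s', hs', hcone⟩ : ∃ s' : ∀ n, D.attach.ker n → D.attach.ker (n + 1),
      (∀ n < m, ∀ x, s' n (kerMap ι.hom ι.hom_aug n x) =
        kerMap ι.hom ι.hom_aug (n + 1) (s n x)) ∧
      ∀ x, s' m (kerMap ι.hom ι.hom_aug m x) = cone x := by
    -- Below m the old contraction is transported along bijections, and in degree m it is the cone.
    -- The value 1 above m is arbitrary.
    refine ⟨Function.update (fun n => if hn : n < m then fun y => kerMap ι.hom ι.hom_aug (n + 1)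
        (s n ((Equiv.ofBijective _ (hbij n hn.le)).symm y)) else fun _ => 1) m
        fun y => cone ((Equiv.ofBijective _ (hbij m le_rfl)).symm y), fun n hn x => ?_,
        fun x => ?_⟩
    · rw [Function.update_of_ne hn.ne, dif_pos hn]
      exact congrArg (fun z => kerMap ι.hom ι.hom_aug (n + 1) (s n z))
        (Equiv.ofBijective_symm_apply_apply _ (hbij n hn.le) x)
    · rw [Function.update_self]
      exact congrArg cone (Equiv.ofBijective_symm_apply_apply _ (hbij m le_rfl) x)
  refine ⟨D.attach, ι, s', hid, hs', fun n hn => ?_⟩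
  rcases hn.lt_or_eq with hn | rfl
  · exact (h n hn).map ι.hom ι.hom_aug (hid n hn.le).1.2 (ι.len_hom n) (ι.len_hom (n + 1))
      fun k hk => hs' k (by omega)
  -- The cone is the simplex 𝟙 of its cell, so its i-th face is the simplex δᵢ, which is the
  -- attached face.
  · have hface : ∀ (i : Fin (n + 2)) (x : T.ker n), D.attach.kerFace i (cone x) =
        kerMap ι.hom ι.hom_aug n (T.coneBd s₀ s n i x) := by
      intro i x
      apply Subtype.ext
      have h₁ := D.op_elt (SimplexCategory.δ i) (𝟙 ⦋n + 1⦌) x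
      have h₂ := D.elt_comp_δ (𝟙 ⦋n⦌) i x
      rw [Category.comp_id] at h₁
      rw [Category.id_comp, op_id, T.X.map_id] at h₂
      exact h₁.trans h₂
    rw [isContractionAt_iff]
    refine ⟨fun y => ?_, fun i y => ?_, ?_⟩
    · obtain ⟨x, rfl⟩ := (hbij n le_rfl).2 y
      rw [hcone, hface, coneBd_last]
    · obtain ⟨x, rfl⟩ := (hbij n le_rfl).2 y
      rw [hcone, hface, coneBd_castSucc, coneFace_kerMap _ _ hs']
    · obtain ⟨C, N, hC⟩ := D.elt_pBounded (𝟙 ⦋n + 1⦌)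
      refine ⟨C, N, fun y => ?_⟩
      obtain ⟨x, rfl⟩ := (hbij n le_rfl).2 y
      rw [hcone]
      refine (hC x).trans_eq ?_
      congr 3
      exact (ι.len_hom n x).symm

end FreeTriple
end

/-! ### Sequential colimits of simplicial groups -/

theorem GrpCat.isIso_of_bijective {G H : GrpCat.{u}} (f : G ⟶ H)
    (hf : Function.Bijective f.hom) : IsIso f :=
  (MulEquiv.ofBijective f.hom hf).toGrpIso.isIso_hom

theorem GrpCat.bijective_of_isIso {G H : GrpCat.{u}} (f : G ⟶ H) [IsIso f] :
    Function.Bijective f.hom :=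
  (asIso f).groupIsoToMulEquiv.bijective

open Limits in
/-- The colimit of a sequence of simplicial groups which is eventually constant in each degree. -/
theorem CategoryTheory.SimplicialObject.exists_sequential_colimit
    (X : ℕ → SimplicialObject GrpCat.{u})
    (j : ∀ k, X k ⟶ X (k + 1))
    (hj : ∀ n k, n ≤ k → Function.Bijective ((j k).app (op ⦋n⦌)).hom)
    (Y : SimplicialObject GrpCat.{u}) (a : ∀ k, X k ⟶ Y) (ha : ∀ k, j k ≫ a (k + 1) = a k) :
    ∃ (X' : SimplicialObject GrpCat.{u}) (c : ∀ k, X k ⟶ X') (a' : X' ⟶ Y),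
      (∀ k, j k ≫ c (k + 1) = c k) ∧ (∀ k, c k ≫ a' = a k) ∧
      ∀ n k, n ≤ k → Function.Bijective ((c k).app (op ⦋n⦌)).hom := by
  let F : ℕ ⥤ SimplicialObject GrpCat.{u} := Functor.ofSequence j
  have hF : ∀ k, F.map (homOfLE (Nat.le_add_right k 1)) = j k := fun k =>
    Functor.ofSequence_map_homOfLE_succ j k
  have hconst : ∀ (n k : ℕ), n ≤ k →
      (F ⋙ (evaluation _ _).obj (op ⦋n⦌)).IsEventuallyConstantFrom k := by
    intro n k hk l f
    obtain ⟨d, rfl⟩ := Nat.exists_eq_add_of_le (leOfHom f)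
    induction d with
    | zero =>
      rw [Subsingleton.elim f (𝟙 k), CategoryTheory.Functor.map_id]
      infer_instance
    | succ d ih =>
      rw [Subsingleton.elim f (homOfLE (Nat.le_add_right k d) ≫
        homOfLE (Nat.le_add_right (k + d) 1)), Functor.map_comp]
      have := ih (homOfLE (Nat.le_add_right k d))
      have : IsIso ((F ⋙ (evaluation _ _).obj (op ⦋n⦌)).map
          (homOfLE (Nat.le_add_right (k + d) 1))) := by
        change IsIso ((F.map (homOfLE (Nat.le_add_right (k + d) 1))).app (op ⦋n⦌))
        rw [hF]
        exact GrpCat.isIso_of_bijective _ (hj n (k + d) (by omega))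
      infer_instance
  -- In each degree the sequence is eventually constant, and colimits of functors are computed
  -- degreewise.
  have : ∀ Δ : SimplexCategoryᵒᵖ, HasColimit (F.flip.obj Δ) := fun Δ =>
    (hconst Δ.unop.len _ le_rfl).hasColimit
  have hcolim : HasColimit F := functorCategoryHasColimit F
  let α : F ⟶ (Functor.const ℕ).obj Y := NatTrans.ofSequence a fun k => by
    rw [hF]
    exact (ha k).trans (Category.comp_id _).symm
  refine ⟨colimit F, fun k => colimit.ι F k, colimit.desc F ⟨Y, α⟩, fun k => ?_, fun k => ?_,
    fun n k hk => ?_⟩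
  · rw [← hF k]
    exact colimit.w F _
  · exact colimit.ι_desc _ _
  · have hc := isColimitOfPreserves ((evaluation _ GrpCat.{u}).obj (op ⦋n⦌))
      (colimit.isColimit F)
    have : IsIso (((evaluation _ _).obj (op ⦋n⦌)).map (colimit.ι F k)) :=
      (hconst n k hk).isIso_ι_of_isColimit hc
    exact GrpCat.bijective_of_isIso (((evaluation _ _).obj (op ⦋n⦌)).map (colimit.ι F k))

/-! ### Unions of triples -/

noncomputable section

namespace FreeTriple

variable {π : Type u} [Group π]

/-- The composite inclusion of the first triple of a sequence in the others. -/
def seqInclusion (T : ℕ → FreeTriple π) (ι : ∀ k, Inclusion (T k) (T (k + 1))) :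
    ∀ k, Inclusion (T 0) (T k) :=
  Nat.rec (Inclusion.refl _) fun k i => i.comp (ι k)

theorem isIdentityAt_seqInclusion (T : ℕ → FreeTriple π) (ι : ∀ k, Inclusion (T k) (T (k + 1)))
    {n : ℕ} (h : ∀ k, (ι k).IsIdentityAt n) (k : ℕ) : (seqInclusion T ι k).IsIdentityAt n := by
  induction k with
  | zero => exact Inclusion.IsIdentityAt.refl _ _
  | succ k ih => exact ih.comp (h k)

/-- The union of a sequence of inclusions of triples which is eventually constant in each
degree. -/
theorem exists_union (T : ℕ → FreeTriple π) (ι : ∀ k, Inclusion (T k) (T (k + 1)))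
    (hι : ∀ n k, n ≤ k → (ι k).IsIdentityAt n) :
    ∃ (T' : FreeTriple π) (c : ∀ k, (T k).X ⟶ T'.X),
      (∀ k, (ι k).hom ≫ c (k + 1) = c k) ∧ (∀ k, c k ≫ T'.aug = (T k).aug) ∧
      (∀ n k, n ≤ k → Function.Bijective ((c k).app (op ⦋n⦌)).hom) ∧
      (∀ n k, n ≤ k → ∀ x, T'.len n (((c k).app (op ⦋n⦌)).hom x) = (T k).len n x) ∧
      ∃ i : Inclusion (T 0) T', ∀ n, (∀ k, (ι k).IsIdentityAt n) → i.IsIdentityAt n := by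
  obtain ⟨X, c, aug, hc, haug, hbij⟩ := SimplicialObject.exists_sequential_colimit
    (fun k => (T k).X) (fun k => (ι k).hom) (fun n k h => (hι n k h).1) _ (fun k => (T k).aug)
    fun k => (ι k).hom_aug
  have happ : ∀ n k x, ((c (k + 1)).app (op ⦋n⦌)).hom (((ι k).hom.app (op ⦋n⦌)).hom x) =
      ((c k).app (op ⦋n⦌)).hom x := fun n k x => by
    rw [← hc k]
    rfl
  have haug' : ∀ n k x, (aug.app (op ⦋n⦌)).hom (((c k).app (op ⦋n⦌)).hom x) =
      ((T k).aug.app (op ⦋n⦌)).hom x := fun n k x => by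
    rw [← haug k]
    rfl
  -- Degree n is stable from stage n on, so its basis and weights are read off there.
  let e : ∀ n, (T n).X _⦋n⦌ ≃* X _⦋n⦌ := fun n => MulEquiv.ofBijective _ (hbij n n le_rfl)
  let b : ∀ n, FreeGroupBasis ((T n).gens n) (X _⦋n⦌) := fun n => ((T n).basis n).map (e n)
  have hlen : ∀ n k, n ≤ k → ∀ x, wordLength (b n) ((T n).weight n)
      (((c k).app (op ⦋n⦌)).hom x) = (T k).len n x := by
    intro n k hk
    induction k, hk using Nat.le_induction with
    | base => exact wordLength_basis_map _ _ (e n)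
    | succ k hk ih =>
      intro x
      obtain ⟨x, rfl⟩ := (hι n k hk).1.2 x
      rw [happ, ih, (ι k).len_hom]
  have hface : ∀ (n k : ℕ) (i : Fin (n + 2)) x,
      (X.δ i).hom (((c k).app (op ⦋n + 1⦌)).hom x) =
        ((c k).app (op ⦋n⦌)).hom (((T k).X.δ i).hom x) := fun n k i x =>
    (congrArg (fun g => g.hom x) ((c k).naturality (SimplexCategory.δ i).op)).symm
  have hdeg : ∀ (n k : ℕ) (i : Fin (n + 1)) x,
      (X.σ i).hom (((c k).app (op ⦋n⦌)).hom x) =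
        ((c k).app (op ⦋n + 1⦌)).hom (((T k).X.σ i).hom x) := fun n k i x =>
    (congrArg (fun g => g.hom x) ((c k).naturality (SimplexCategory.σ i).op)).symm
  let T' : FreeTriple π :=
    { X := X
      aug := aug
      aug_surjective := fun g => by
        obtain ⟨x, hx⟩ := (T 0).aug_surjective g
        exact ⟨_, (haug' 0 0 x).trans hx⟩
      gens := fun n => (T n).gens n
      countable_gens := fun n => (T n).countable_gens n
      basis := b
      weight := fun n => (T n).weight n
      face_pBounded := fun n i => by
        -- Degrees n and n + 1 are both stable at stage n + 1.
        obtain ⟨C, N, h⟩ := (T (n + 1)).face_pBounded n i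
        refine ⟨C, N, fun y => ?_⟩
        obtain ⟨x, rfl⟩ := (hbij (n + 1) (n + 1) le_rfl).2 y
        rw [hface, hlen _ _ (Nat.le_succ n), hlen _ _ le_rfl]
        exact h x
      degeneracy_pBounded := fun n i => by
        obtain ⟨C, N, h⟩ := (T (n + 1)).degeneracy_pBounded n i
        refine ⟨C, N, fun y => ?_⟩
        obtain ⟨x, rfl⟩ := (hbij n (n + 1) (Nat.le_succ n)).2 y
        rw [hdeg, hlen _ _ (Nat.le_succ n), hlen _ _ le_rfl]
        exact h x }
  have hseq : ∀ k, (seqInclusion T ι k).hom ≫ c k = c 0 := by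
    intro k
    induction k with
    | zero => exact Category.id_comp _
    | succ k ih => exact (Category.assoc _ _ _).trans ((congrArg _ (hc k)).trans ih)
  have hseq' : ∀ n k x, ((c k).app (op ⦋n⦌)).hom
      (((seqInclusion T ι k).hom.app (op ⦋n⦌)).hom x) = ((c 0).app (op ⦋n⦌)).hom x :=
    fun n k x => by
      rw [← hseq k]
      rfl
  refine ⟨T', c, hc, haug, hbij, hlen,
    { hom := c 0
      hom_aug := haug 0
      injective := fun n x y hxy => by
        -- `c 0` need not be bijective in degree n, but it factors through stage n, where `c n` is.
        rw [← hseq' n n, ← hseq' n n] at hxy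
        exact (seqInclusion T ι n).injective n ((hbij n n le_rfl).1 hxy)
      genMap := fun n => (seqInclusion T ι n).genMap n
      hom_basis := fun n x => by
        rw [← hseq' n n, (seqInclusion T ι n).hom_basis]
        rfl
      weight_genMap := fun n x => (seqInclusion T ι n).weight_genMap n x
      augLen_eq := augLen_eq_of_surjective (T 0) T' _ (hbij 0 0 le_rfl).2 (haug' 0 0)
        (hlen 0 0 le_rfl) }, fun n hn => ⟨?_, ?_⟩⟩
  · have := (hbij n n le_rfl).comp (isIdentityAt_seqInclusion T ι hn n).1
    convert this using 1
    ext1 x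
    exact (hseq' n n x).symm
  · exact (isIdentityAt_seqInclusion T ι hn n).2

/-- A triple together with a contraction through dimension `m - 1`. -/
structure Stage (π : Type u) [Group π] (m : ℕ) where
  /-- the triple -/
  T : FreeTriple π
  /-- the base point -/
  s₀ : T.ker 0
  /-- the contraction -/
  s : ∀ n, T.ker n → T.ker (n + 1)
  contr : ∀ n < m, T.IsContractionAt s₀ s n

/-! ### Iteration and the resolution -/

namespace Stage

variable {m : ℕ}

theorem exists_next (S : Stage π m) : ∃ (S' : Stage π (m + 1)) (ι : Inclusion S.T S'.T),
    (∀ n ≤ m, ι.IsIdentityAt n) ∧ S'.s₀ = kerMap ι.hom ι.hom_aug 0 S.s₀ ∧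
      ∀ n < m, ∀ x, S'.s n (kerMap ι.hom ι.hom_aug n x) =
        kerMap ι.hom ι.hom_aug (n + 1) (S.s n x) := by
  obtain ⟨T', ι, s', h1, h2, h3⟩ := S.T.exists_extend_contraction m S.s₀ S.s S.contr
  exact ⟨⟨T', _, s', fun n hn => h3 n (Nat.le_of_lt_succ hn)⟩, ι, h1, rfl, h2⟩

/-- The stage with a contraction in one more dimension. -/
def next (S : Stage π m) : Stage π (m + 1) := S.exists_next.choose

/-- The iterated extension of the contraction. -/
def iter (S : Stage π m) : ∀ k, Stage π (m + k) := Nat.rec S fun _ S' => S'.next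

end Stage

/-- A simplicial contraction of the kernel of the augmentation makes a triple a resolution. -/
theorem isResolution_of_contraction (T : FreeTriple π) (s₀ : T.ker 0)
    (s : ∀ n, T.ker n → T.ker (n + 1)) (h : ∀ n, T.IsContractionAt s₀ s n) : T.IsResolution := by
  have hmul : ∀ (n : ℕ) (i : Fin (n + 2)) (x y : T.ker (n + 1)),
      (T.X.δ i).hom (x.1 * y.1⁻¹) = (T.kerFace i x).1 * (T.kerFace i y).1⁻¹ := fun n i x y => by
    rw [map_mul, map_inv]
    rfl
  have hone : ∀ (n : ℕ) (i : Fin (n + 2)), T.kerFace i (1 : T.ker (n + 1)) = 1 := fun n i =>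
    Subtype.ext (map_one (T.X.δ i).hom)
  simp only [isContractionAt_iff] at h
  -- `s` need not fix 1. Dividing by s(1) makes all faces but the last trivial, and leaves the last
  -- face equal to x.
  refine ⟨fun x hx => ⟨(s 0 ⟨x, hx⟩).1 * (s 0 1).1⁻¹, ?_, ?_⟩, fun n x hx => ?_⟩
  · rw [hmul]
    have h0 := fun y => (h 0).2.1 0 y
    rw [Fin.castSucc_zero] at h0
    rw [h0, h0]
    exact mul_inv_cancel _
  · rw [hmul]
    have h0 := (h 0).1
    rw [show Fin.last (0 + 1) = 1 from rfl] at h0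
    rw [h0, h0]
    simp
  · have hx' : x ∈ T.ker (n + 1) := by
      have := T.aug_map (SimplexCategory.δ (0 : Fin (n + 2))) x
      have h0 : (T.X.map (SimplexCategory.δ (0 : Fin (n + 2))).op).hom x = 1 := hx 0
      rw [h0, map_one] at this
      exact this.symm
    have hx1 : ∀ i, T.kerFace i ⟨x, hx'⟩ = 1 := fun i => Subtype.ext (hx i)
    refine ⟨(s (n + 1) ⟨x, hx'⟩).1 * (s (n + 1) 1).1⁻¹, fun i => ?_, ?_⟩
    · rw [hmul, (h (n + 1)).2.1, (h (n + 1)).2.1]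
      change (s n _).1 * (s n _).1⁻¹ = 1
      rw [hx1, hone]
      exact mul_inv_cancel _
    · rw [hmul, (h (n + 1)).1, (h (n + 1)).1]
      simp

/-- A triple of type `P(m)` embeds in a type `P` resolution without changes in degrees `≤ m`. -/
theorem IsTypePUpTo.exists_inclusion {T : FreeTriple π} {m : ℕ} (h : T.IsTypePUpTo m) :
    ∃ (T' : FreeTriple π) (ι : Inclusion T T'), T'.IsTypePResolution ∧
      ∀ n ≤ m, ι.IsIdentityAt n := by
  obtain ⟨s₀, s, hs⟩ := h
  let S : ∀ k, Stage π (m + k) := Stage.iter ⟨T, s₀, s, hs⟩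
  have hnext : ∀ k, ∃ ι : Inclusion (S k).T (S (k + 1)).T,
      (∀ n ≤ m + k, ι.IsIdentityAt n) ∧ (S (k + 1)).s₀ = kerMap ι.hom ι.hom_aug 0 (S k).s₀ ∧
      ∀ n < m + k, ∀ x, (S (k + 1)).s n (kerMap ι.hom ι.hom_aug n x) =
        kerMap ι.hom ι.hom_aug (n + 1) ((S k).s n x) := fun k => (S k).exists_next.choose_spec
  choose ι hid hs₀ hcomp using hnext
  obtain ⟨T', c, hc, haug, hbij, hlen, i, hi⟩ := exists_union (fun k => (S k).T) ι
    fun n k hnk => hid k n (by omega)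
  refine ⟨T', i, ?_, fun n hn => hi n fun k => hid k n (by omega)⟩
  have hker : ∀ n k x, kerMap (c (k + 1)) (haug (k + 1)) n (kerMap (ι k).hom (ι k).hom_aug n x) =
      kerMap (c k) (haug k) n x := fun n k x => by
    apply Subtype.ext
    change ((c (k + 1)).app _).hom (((ι k).hom.app _).hom x.1) = ((c k).app _).hom x.1
    rw [← hc k]
    rfl
  have hbijk : ∀ n k, n ≤ k → Function.Bijective (kerMap (c k) (haug k) n) := fun n k hnk =>
    kerMap_bijective _ _ (hbij n k hnk)
  have hbase : ∀ k, kerMap (c k) (haug k) 0 (S k).s₀ = kerMap (c 0) (haug 0) 0 (S 0).s₀ := by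
    intro k
    induction k with
    | zero => rfl
    | succ k ih => rw [hs₀, hker, ih]
  -- At stage n + 1 degrees n and n + 1 are stable and the contraction is already valid in degree n;
  -- `hs'` shows that later stages give the same map.
  let s' : ∀ n, T'.ker n → T'.ker (n + 1) := fun n y =>
    kerMap (c (n + 1)) (haug (n + 1)) (n + 1) ((S (n + 1)).s n
      ((Equiv.ofBijective _ (hbijk n (n + 1) n.le_succ)).symm y))
  have hs' : ∀ n k, n < k → ∀ x, s' n (kerMap (c k) (haug k) n x) =
      kerMap (c k) (haug k) (n + 1) ((S k).s n x) := by
    intro n k hnk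
    induction k, (Nat.succ_le_of_lt hnk) using Nat.le_induction with
    | base =>
      intro x
      exact congrArg (fun z => kerMap (c (n + 1)) (haug (n + 1)) (n + 1) ((S (n + 1)).s n z))
        (Equiv.ofBijective_symm_apply_apply _ (hbijk n (n + 1) n.le_succ) x)
    | succ k hk ih =>
      intro x
      obtain ⟨x, rfl⟩ := (kerMap_bijective (ι k).hom (ι k).hom_aug
        (hid k n (by omega)).1).2 x
      rw [hker, ih (by omega), hcomp k n (by omega), hker]
  have hcontr : ∀ n, T'.IsContractionAt (kerMap (c 0) (haug 0) 0 (S 0).s₀) s' n := by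
    intro n
    rw [← hbase (n + 1)]
    exact ((S (n + 1)).contr n (by omega)).map (c (n + 1)) (haug (n + 1))
      (hbij n (n + 1) n.le_succ).2 (hlen n (n + 1) n.le_succ) (hlen (n + 1) (n + 1) le_rfl)
      fun k hk => hs' k (n + 1) (by omega)
  exact ⟨T'.isResolution_of_contraction _ s' hcontr, _, s', hcontr⟩

/-- The condition is vacuous, so the unconditional embedding is the case m = 0. -/
theorem isTypePUpTo_zero (T : FreeTriple π) : T.IsTypePUpTo 0 :=
  ⟨1, fun _ _ => 1, fun _ h => absurd h (Nat.not_lt_zero _)⟩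

/-- The constant simplicial group on the free group on the elements of `π`. -/
def constFree (π : Type u) [Group π] [Countable π] : FreeTriple π where
  X := (SimplicialObject.const GrpCat.{u}).obj (GrpCat.of (FreeGroup π))
  aug := (SimplicialObject.const GrpCat.{u}).map (GrpCat.ofHom (FreeGroup.lift id))
  aug_surjective g := ⟨FreeGroup.of g, FreeGroup.lift_apply_of⟩
  gens _ := π
  countable_gens _ := inferInstance
  basis _ := FreeGroupBasis.ofFreeGroup π
  weight _ _ := 1
  face_pBounded _ _ := IsPBounded.of_le fun _ => Nat.le_add_left _ _
  degeneracy_pBounded _ _ := IsPBounded.of_le fun _ => Nat.le_add_left _ _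

end FreeTriple
end

theorem theoremA1 :
    (∀ (π : Type u) [Group π] (T : FreeTriple π),
      (∃ (T' : FreeTriple π) (_ : FreeTriple.Inclusion T T'), T'.IsTypePResolution) ∧
      ∀ m : ℕ, T.IsTypePUpTo m →
        ∃ (T' : FreeTriple π) (ι : FreeTriple.Inclusion T T'), T'.IsTypePResolution ∧
          ∀ n ≤ m, ι.IsIdentityAt n) ∧
    (∀ (π : Type u) [Group π] [Countable π], ∃ T : FreeTriple π, T.IsTypePResolution) := by
  refine ⟨fun π _ T => ⟨?_, fun m h => h.exists_inclusion⟩, fun π _ _ => ?_⟩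
  · obtain ⟨T', ι, h, -⟩ := T.isTypePUpTo_zero.exists_inclusion
    exact ⟨T', ι, h⟩
  · obtain ⟨T', -, h, -⟩ := (FreeTriple.constFree π).isTypePUpTo_zero.exists_inclusion
    exact ⟨T', h⟩
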